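/- For $n\ge 1$ and $\pi\in\mathfrak S_n$, the up-down runs of $\pi$ are the maximal consecutive subsequences (of length at least $2$) of the word $0\,\pi(1)\,\pi(2)\cdots\pi(n)$ that are increasing or decreasing. Let $T(n,k)$ be the number of permutations in $\mathfrak S_n$ with exactly $k$ up-down runs, put $\xi(n,k)=T(n,2k+1)$ and $\zeta(n,k)=2\,T(n,2k+2)$, and let $$\xi_n(x)=\sum_{k\ge 0}\xi(n,k)x^k,\qquad \zeta_n(x)=\sum_{k\ge 0}\zeta(n,k)x^k,\qquad f_n(x)=2\xi_n(x^2)+x\,\zeta_n(x^2).$$ Let $p,q$ be nonzero real polynomials with only real zeros, and let $u_1\le u_2\le\cdots\le u_r$ and $v_1\le v_2\le\cdots\le v_s$ be the zeros, listed with multiplicity, of $p$ and $q$ respectively. We say that $p$ interlaces $q$ if $\deg q=1+\deg p$ and $v_1\le u_1\le v_2\le u_2\le\cdots\le u_r\le v_{r+1}$, and that $p$ alternates left of $q$ if $\deg p=\deg q$ and $u_1\le v_1\le u_2\le v_2\le\cdots\le u_r\le v_r$. **Theorem.** 1. $f_1(x)=2$, and for all $n\ge 1$, $$f_{n+1}(x)=\bigl(1+x+(n-1)x^2\bigr)f_n(x)+x(1-x^2)\frac{\mathrm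 d}{\mathrm dx}f_n(x).$$ 2. For all $n\ge 1$, every complex zero of $f_n$ is real and lies in $[-1,0)$, and $f_n$ interlaces $f_{n+1}$. More precisely, $f_n$ has exactly $\lfloor (n-1)/2\rfloor$ zeros in $(-1,0)$, all of them simple, and the multiplicity of $-1$ as a zero of $f_n$ is $\lfloor n/2\rfloor$ (where multiplicity $0$ means that $-1$ is not a zero). 3. All complex zeros of $\xi_n$ (for $n\ge 1$) and of $\zeta_n$ (for $n\ge 2$) are real, negative and simple, and these polynomials are not identically zero. 4. For all $n\ge 1$, $\zeta_{2n}$ alternates left of $\xi_{2n}$, and $\zeta_{2n+1}$ interlaces $\xi_{2n+1}$. -/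

import Mathlib

open Polynomial

noncomputable section

/-- The word `0 π(1) π(2) … π(n)` of a permutation `π` of `[n]`, with a `0` put in front.
The index and value set `[n] = {1, …, n}` is realised as `Fin n`, shifted by one. -/
def frontedWord {n : ℕ} (π : Equiv.Perm (Fin n)) : Fin (n + 1) → ℕ :=
  Fin.cons 0 (fun i => (π i : ℕ) + 1)

/-- The consecutive subsequence `w a, …, w b` (with at least two entries) is increasing or
decreasing. -/
def IsMonotoneSegment {m : ℕ} (w : Fin m → ℕ) (a b : Fin m) : Prop :=
  a < b ∧ (StrictMonoOn w (Set.Icc a b) ∨ StrictAntiOn w (Set.Icc a b))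

/-- A run: a monotone segment that is not contained in a larger one. -/
def IsMaximalRun {m : ℕ} (w : Fin m → ℕ) (a b : Fin m) : Prop :=
  IsMonotoneSegment w a b ∧
    ∀ a' b' : Fin m, a' ≤ a → b ≤ b' → IsMonotoneSegment w a' b' → a' = a ∧ b' = b

/-- The number of up-down runs of `π`. -/
def udrun {n : ℕ} (π : Equiv.Perm (Fin n)) : ℕ :=
  {p : Fin (n + 1) × Fin (n + 1) | IsMaximalRun (frontedWord π) p.1 p.2}.ncard

/-- `T(n,k)`: the number of permutations of `[n]` with `k` up-down runs. -/
def udrunCount (n k : ℕ) : ℕ :=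
  {π : Equiv.Perm (Fin n) | udrun π = k}.ncard

/-- `ξ(n,k) = T(n,2k+1)`. -/
def xiCoeff (n k : ℕ) : ℕ := udrunCount n (2 * k + 1)

/-- `ζ(n,k) = 2 T(n,2k+2)`. -/
def zetaCoeff (n k : ℕ) : ℕ := 2 * udrunCount n (2 * k + 2)

/-- `ξ_n(x) = ∑_{k ≥ 0} ξ(n,k) x^k`; a permutation of `[n]` has at most `n` up-down runs, so the
terms with `k > n` vanish. -/
def xiPoly (n : ℕ) : ℝ[X] := ∑ k ∈ Finset.range (n + 1), C (xiCoeff n k : ℝ) * X ^ k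

/-- `ζ_n(x) = ∑_{k ≥ 0} ζ(n,k) x^k`; again the terms with `k > n` vanish. -/
def zetaPoly (n : ℕ) : ℝ[X] := ∑ k ∈ Finset.range (n + 1), C (zetaCoeff n k : ℝ) * X ^ k

/-- `f_n(x) = 2 ξ_n(x²) + x ζ_n(x²)`. -/
def fPoly (n : ℕ) : ℝ[X] := C 2 * (xiPoly n).comp (X ^ 2) + X * (zetaPoly n).comp (X ^ 2)

/-- `p ∈ RZ(I)`: `p` is a nonzero real polynomial all of whose complex zeros are real and lie
in `I`. The class `RZ` is the case `I = ℝ`. -/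
def RZ (I : Set ℝ) (p : ℝ[X]) : Prop :=
  p ≠ 0 ∧ ∀ z : ℂ, aeval z p = 0 → ∃ x ∈ I, z = (x : ℂ)

/-- `p` interlaces `q`: both have only real zeros, `deg q = 1 + deg p`, and the zeros
`u 0 ≤ u 1 ≤ …` of `p` and `v 0 ≤ v 1 ≤ …` of `q`, listed with multiplicity, satisfy
`v 0 ≤ u 0 ≤ v 1 ≤ u 1 ≤ …`. -/
def Interlaces (p q : ℝ[X]) : Prop :=
  RZ Set.univ p ∧ RZ Set.univ q ∧ q.natDegree = 1 + p.natDegree ∧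
    ∃ (u : Fin p.natDegree → ℝ) (v : Fin (p.natDegree + 1) → ℝ),
      Monotone u ∧ Monotone v ∧
      p.roots = Finset.univ.val.map u ∧ q.roots = Finset.univ.val.map v ∧
      ∀ i : Fin p.natDegree, v i.castSucc ≤ u i ∧ u i ≤ v i.succ

/-- `p` alternates left of `q`: both have only real zeros, `deg p = deg q`, and the zeros
`u 0 ≤ u 1 ≤ …` of `p` and `v 0 ≤ v 1 ≤ …` of `q`, listed with multiplicity, satisfy
`u 0 ≤ v 0 ≤ u 1 ≤ v 1 ≤ …`. -/
def AlternatesLeft (p q : ℝ[X]) : Prop :=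
  RZ Set.univ p ∧ RZ Set.univ q ∧ p.natDegree = q.natDegree ∧
    ∃ u v : Fin p.natDegree → ℝ,
      Monotone u ∧ Monotone v ∧
      p.roots = Finset.univ.val.map u ∧ q.roots = Finset.univ.val.map v ∧
      (∀ i, u i ≤ v i) ∧ ∀ i j : Fin p.natDegree, (i : ℕ) + 1 = j → v i ≤ u j

/-- All zeros of `p` are real, negative and simple. -/
def OnlyNegativeSimpleZeros (p : ℝ[X]) : Prop :=
  RZ (Set.Iio 0) p ∧ ∀ x : ℝ, p.IsRoot x → p.rootMultiplicity x = 1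

end

/-! Every maximal run but the first begins at a turn of the up-down pattern of `0 π(1) … π(n)`, so
the number of runs is one more than the number of turns, and `f_n` is twice the generating
polynomial of turns. Each permutation arises uniquely by inserting a new maximum, which replaces one
step of the pattern by an ascent and a descent, or appends an ascent. For a pattern on `n + 1` steps
with `k` turns and initial ascent, `k + 1` insertions preserve `k`, one adds a turn, and `n - k` add
two (`sum_X_pow_turns_insertPeak`). Since `k x^k = x (x^k)'`, this is the recurrence.

For the zeros, write `f_n = (1 + x)^⌊n/2⌋ g_n`. The recurrence turns into one for `g_n`, in which
the value at a zero of `g_n` in `(-1, 0)` is a negative multiple of `g_n'`. The signs of `g_n'`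
alternate along the zeros; together with the signs at `0` and, in every second step, at `-1`, they
locate all zeros of `g_{n+1}` by the intermediate value theorem
(`exists_eq_rootsProd_of_alternating`).

Finally `ξ_n` and `ζ_n` are handled by a Hermite–Biehler argument (`exists_even_odd_eq_rootsProd`):
`2 ξ_n(-y²)` and `y ζ_n(-y²)` are the real and imaginary parts of `f_n(iy)`. As all zeros of `f_n`
are negative, the argument of `f_n(iy)` grows from `0` towards `(n-1)π/2`. It passes through odd
multiples of `π/2`, giving zeros of `ξ_n`, and through even ones, giving zeros of `ζ_n`,
alternately; the degrees leave room for no others. -/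

/-! ### Turns of up-down patterns under insertion of a peak -/

/-- The number of indices `i < m` at which the up-down pattern `s` changes direction. -/
def turns (s : ℕ → Bool) (m : ℕ) : ℕ :=
  ∑ i ∈ Finset.range m, if s i = s (i + 1) then 0 else 1

/-- The up-down pattern with its `p`-th step replaced by an ascent followed by a descent. -/
def insertPeak (p : ℕ) (s : ℕ → Bool) (j : ℕ) : Bool :=
  if j < p then s j else if j = p then true else if j = p + 1 then false else s (j - 1)

theorem turns_succ (s : ℕ → Bool) (m : ℕ) :
    turns s (m + 1) = turns (fun i => s (i + 1)) m + if s 0 = s 1 then 0 else 1 := by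
  simp [turns, Finset.sum_range_succ']

theorem turns_congr {s t : ℕ → Bool} {m : ℕ} (h : ∀ i ≤ m, s i = t i) :
    turns s m = turns t m := by
  refine Finset.sum_congr rfl fun i hi => ?_
  have hi := Finset.mem_range.1 hi
  rw [h i hi.le, h (i + 1) hi]

theorem insertPeak_succ_shift (p : ℕ) (s : ℕ → Bool) :
    (fun i => insertPeak (p + 1) s (i + 1)) = insertPeak p (fun i => s (i + 1)) := by
  funext i
  simp only [insertPeak]
  split_ifs <;> first | rfl | omega | (congr 1; omega)

theorem turns_insertPeak_zero (s : ℕ → Bool) (m : ℕ) :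
    turns (insertPeak 0 s) (m + 2) =
      turns (fun i => s (i + 1)) m + (if s 1 = false then 0 else 1) + 1 := by
  rw [turns_succ, turns_succ]
  have : (fun i => insertPeak 0 s (i + 1 + 1)) = fun i => s (i + 1) := by
    funext i; simp [insertPeak]
  rw [this]
  rcases h : s 1 <;> simp [insertPeak, h]

theorem turns_insertPeak_zero_of_false (s : ℕ → Bool) (m : ℕ) (h : s 0 = false) :
    turns (insertPeak 0 s) (m + 1) = turns s m + 1 := by
  rw [turns_succ]
  have : (fun i => insertPeak 0 s (i + 1)) = s := by
    funext i
    rcases i with _ | i <;> simp [insertPeak, h]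
  rw [this]
  simp [insertPeak]

theorem turns_insertPeak_succ (p : ℕ) (s : ℕ → Bool) (m : ℕ) :
    turns (insertPeak (p + 1) s) (m + 1) =
      turns (insertPeak p (fun i => s (i + 1))) m
        + if s 0 = insertPeak p (fun i => s (i + 1)) 0 then 0 else 1 := by
  rw [turns_succ, insertPeak_succ_shift]
  rw [show insertPeak (p + 1) s 1 = insertPeak p (fun i => s (i + 1)) 0 from
    congrFun (insertPeak_succ_shift p s) 0]
  simp [insertPeak]

/-- Distribution of the number of turns over all ways to insert a peak. -/
theorem sum_X_pow_turns_insertPeak (m : ℕ) (s : ℕ → Bool) :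
    (s 0 = true → ∑ p ∈ Finset.range (m + 2), (X : ℝ[X]) ^ turns (insertPeak p s) (m + 1) =
      (((turns s m : ℕ) : ℝ[X]) + 1) * X ^ turns s m + X ^ (turns s m + 1)
        + ((m : ℝ[X]) - ((turns s m : ℕ) : ℝ[X])) * X ^ (turns s m + 2)) ∧
    (s 0 = false → ∑ p ∈ Finset.range (m + 2), (X : ℝ[X]) ^ turns (insertPeak p s) (m + 1) =
      ((turns s m : ℕ) : ℝ[X]) * X ^ turns s m + 2 * X ^ (turns s m + 1)
        + ((m : ℝ[X]) - ((turns s m : ℕ) : ℝ[X])) * X ^ (turns s m + 2)) := by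
  induction m generalizing s with
  | zero =>
    constructor <;> intro h
    · simp [Finset.sum_range_succ, turns, insertPeak, h]
      ring
    · simp [Finset.sum_range_succ, turns, insertPeak, h]
      ring
  -- Induct by removing the first step. For positions at least `2` the comparison of the first two
  -- steps is unaffected; positions `0` and `1` are split off because they alter one of these two
  -- steps.
  | succ m ih =>
    obtain ⟨ihU, ihD⟩ := ih (fun i => s (i + 1))
    rw [Finset.sum_range_succ'] at ihU ihD
    rw [Finset.sum_range_succ', Finset.sum_range_succ', turns_insertPeak_zero]
    have h1 := turns_insertPeak_succ 0 s (m + 1)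
    have h2 : ∀ p, turns (insertPeak (p + 1 + 1) s) (m + 1 + 1) =
        turns (insertPeak (p + 1) (fun i => s (i + 1))) (m + 1)
          + if s 0 = s 1 then 0 else 1 := fun p => by
      rw [turns_insertPeak_succ]; simp [insertPeak]
    have h3 : insertPeak 0 (fun i => s (i + 1)) 0 = true := by simp [insertPeak]
    have h4 := turns_insertPeak_zero_of_false (fun i => s (i + 1)) m
    rw [h3] at h1
    simp only [zero_add] at h1 h4 ihU ihD ⊢
    rw [h1, turns_succ s m]
    simp only [h2, pow_add, ← Finset.sum_mul] at ihU ihD ⊢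
    generalize turns (fun i => s (i + 1)) m = k at *
    generalize turns (insertPeak 0 fun i => s (i + 1)) (m + 1) = l at *
    generalize ∑ p ∈ Finset.range (m + 1),
      (X : ℝ[X]) ^ turns (insertPeak (p + 1) fun i => s (i + 1)) (m + 1) = S at *
    -- If the tail starts with a descent, `h4` determines `l`; otherwise the unknown power `X ^ l`
    -- cancels against the one in `ihU`.
    rcases h0 : s 0 <;> rcases h1' : s 1 <;> simp [h1'] at ihU ihD h4 ⊢
    · subst h4
      linear_combination ihD
    · linear_combination (X : ℝ[X]) * ihU
    · subst h4
      linear_combination (X : ℝ[X]) * ihD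
    · linear_combination ihU

/-! ### Counting runs by turns -/

theorem rel_of_forall_rel_succ_of_mem_Ico {α : Type*} (r : α → α → Prop) [IsTrans α r]
    (W : ℕ → α) {a b : ℕ} (h : ∀ i, a ≤ i → i < b → r (W i) (W (i + 1))) {x y : ℕ} (hx : a ≤ x)
    (hxy : x < y) (hy : y ≤ b) : r (W x) (W y) := by
  induction y, hxy using Nat.le_induction with
  | base => exact h x hx hy
  | succ k hk ih => exact _root_.trans (ih (by omega)) (h k (by omega) (by omega))

/-- The up-down pattern of a word: `true` at the ascents, `false` at the descents. -/
def ascentPattern (W : ℕ → ℕ) (i : ℕ) : Bool := decide (W i < W (i + 1))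

/-- Transitivity reduces strict monotonicity to single steps; `hne` excludes level steps, which the
pattern would record as descents. -/
theorem isMonotoneSegment_iff {n : ℕ} (w : Fin (n + 1) → ℕ) (W : ℕ → ℕ)
    (hW : ∀ i : Fin (n + 1), w i = W i) (hne : ∀ i < n, W i ≠ W (i + 1)) (a b : Fin (n + 1)) :
    IsMonotoneSegment w a b ↔ a < b ∧
      ∀ i : ℕ, (a : ℕ) ≤ i → i < b → ascentPattern W i = ascentPattern W a := by
  refine and_congr_right fun hab => ?_
  have hab' : (a : ℕ) < b := hab
  have hb := b.isLt
  constructor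
  · have key : ∀ i (h : i < n), (a : ℕ) ≤ i → i < b →
        (⟨i, by omega⟩ : Fin (n + 1)) ∈ Set.Icc a b ∧
          (⟨i + 1, by omega⟩ : Fin (n + 1)) ∈ Set.Icc a b ∧
          (⟨i, by omega⟩ : Fin (n + 1)) < ⟨i + 1, by omega⟩ := fun i h h1 h2 => by
      simp only [Set.mem_Icc, Fin.le_def, Fin.lt_def]; omega
    rintro (h | h)
    · have : ∀ i : ℕ, (a : ℕ) ≤ i → i < b → ascentPattern W i = true := fun i h1 h2 => by
        obtain ⟨k1, k2, k3⟩ := key i (by omega) h1 h2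
        have := h k1 k2 k3
        rw [hW, hW] at this
        simpa [ascentPattern] using this
      intro i h1 h2
      rw [this i h1 h2, this a le_rfl hab']
    · have : ∀ i : ℕ, (a : ℕ) ≤ i → i < b → ascentPattern W i = false := fun i h1 h2 => by
        obtain ⟨k1, k2, k3⟩ := key i (by omega) h1 h2
        have := h k1 k2 k3
        rw [hW, hW] at this
        simpa [ascentPattern] using this.le
      intro i h1 h2
      rw [this i h1 h2, this a le_rfl hab']
  · intro h
    rcases hs : ascentPattern W a
    · right
      intro x hx y hy hxy
      rw [hW, hW]
      refine rel_of_forall_rel_succ_of_mem_Ico (· > ·) W (a := a) (b := b) (fun i h1 h2 => ?_)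
        hx.1 hxy hy.2
      have := h i h1 h2
      rw [hs] at this
      simp only [ascentPattern, decide_eq_false_iff_not, not_lt] at this
      exact lt_of_le_of_ne this (hne i (by omega)).symm
    · left
      intro x hx y hy hxy
      rw [hW, hW]
      refine rel_of_forall_rel_succ_of_mem_Ico (· < ·) W (a := a) (b := b) (fun i h1 h2 => ?_)
        hx.1 hxy hy.2
      have := h i h1 h2
      rw [hs] at this
      simpa [ascentPattern] using this

/-- A maximal run is determined by its left end, and the left ends are `0` and the positions where a
turn occurs, so it suffices to count these. -/
theorem ncard_isMaximalRun {n : ℕ} (w : Fin (n + 2) → ℕ) (W : ℕ → ℕ)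
    (hW : ∀ i : Fin (n + 2), w i = W i) (hne : ∀ i < n + 1, W i ≠ W (i + 1)) :
    {p : Fin (n + 2) × Fin (n + 2) | IsMaximalRun w p.1 p.2}.ncard =
      turns (ascentPattern W) n + 1 := by
  have iff := isMonotoneSegment_iff w W hW hne
  set s := ascentPattern W with hs
  have himg : (fun p : Fin (n + 2) × Fin (n + 2) => (p.1 : ℕ)) ''
      {p : Fin (n + 2) × Fin (n + 2) | IsMaximalRun w p.1 p.2} =
      (insert 0 (((Finset.range n).filter fun i => s i ≠ s (i + 1)).map
        ⟨Nat.succ, Nat.succ_injective⟩) : Finset ℕ) := by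
    ext a
    simp only [Set.mem_image, Set.mem_ofPred_eq, Prod.exists, Finset.coe_insert, Finset.coe_map,
      Set.mem_insert_iff, Function.Embedding.coeFn_mk, Finset.mem_coe, Finset.mem_filter,
      Finset.mem_range]
    constructor
    · rintro ⟨a, b, ⟨h, hmax⟩, rfl⟩
      obtain ⟨hab, h⟩ := (iff a b).1 h
      have hab' : (a : ℕ) < b := hab
      rcases ha : (a : ℕ) with _ | k
      · exact Or.inl rfl
      refine Or.inr ⟨k, ⟨by omega, fun hk => ?_⟩, rfl⟩
      have := (hmax ⟨k, by omega⟩ b (Fin.le_def.2 (by simp; omega)) le_rfl ((iff _ _).2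
        ⟨Fin.lt_def.2 (by simp; omega), fun i h1 h2 => ?_⟩)).1
      · rw [Fin.ext_iff] at this
        simp at this; omega
      · simp only at h1 ⊢
        rcases h1.eq_or_lt with rfl | h1
        · rfl
        · rw [h i (by omega) h2, ha, hk]
    · intro ha
      have han : a < n + 1 := by
        rcases ha with rfl | ⟨k, ⟨hk, -⟩, rfl⟩ <;> simp; omega
      have hprev : ∀ k, k + 1 = a → s k ≠ s (k + 1) := by
        rintro k rfl
        rcases ha with h | ⟨j, ⟨-, hj⟩, h⟩
        · simp at h
        · obtain rfl : j = k := Nat.succ_injective h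
          exact hj
      let A : Fin (n + 2) := ⟨a, by omega⟩
      -- Extend to the right as far as possible; to the left, the turn at `A` blocks any extension
      -- unless `A` is already the first position.
      obtain ⟨b, hb, hbmax⟩ := (Set.toFinite {b | IsMonotoneSegment w A b}).exists_maximal
        ⟨⟨a + 1, by omega⟩, (iff _ _).2 ⟨Fin.lt_def.2 (by simp [A]), fun i h1 h2 => by
          simp only [A] at h1 h2 ⊢
          rw [show i = a by omega]⟩⟩
      refine ⟨A, b, ⟨hb, fun a' b' h1 h2 hseg => ?_⟩, rfl⟩
      have haa : a' = A := by
        by_contra hne'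
        have hlt : (a' : ℕ) < a := Fin.lt_def.1 (lt_of_le_of_ne h1 hne')
        have hAb : a < (b : ℕ) := Fin.lt_def.1 hb.1
        have hbb : (b : ℕ) ≤ b' := h2
        have h := ((iff _ _).1 hseg).2
        obtain ⟨k, rfl⟩ : ∃ k, a = k + 1 := ⟨a - 1, by omega⟩
        exact hprev k rfl ((h k (by omega) (by omega)).trans
          (h (k + 1) (by omega) (by omega)).symm)
      subst haa
      exact ⟨rfl, le_antisymm (hbmax hseg h2) h2⟩
  have hinj : Set.InjOn (fun p : Fin (n + 2) × Fin (n + 2) => (p.1 : ℕ))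
      {p : Fin (n + 2) × Fin (n + 2) | IsMaximalRun w p.1 p.2} := by
    rintro ⟨a, b⟩ h ⟨a', b'⟩ h' heq
    obtain rfl : a = a' := Fin.ext heq
    rcases le_total b b' with hb | hb
    · rw [(h.2 a b' le_rfl hb h'.1).2]
    · rw [(h'.2 a b le_rfl hb h.1).2]
  rw [← hinj.ncard_image, himg, Set.ncard_coe_finset, Finset.card_insert_of_notMem
    (by simp), Finset.card_map, Finset.card_filter, turns]
  simp [ite_not]

/-! ### Permutation words and insertion of the maximum -/

/-- The word `0 π(1) … π(n)`, continued by `0` to all natural numbers. -/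
def permWord {n : ℕ} (π : Equiv.Perm (Fin n)) (j : ℕ) : ℕ :=
  if h : j < n + 1 then frontedWord π ⟨j, h⟩ else 0

@[simp] theorem permWord_zero {n : ℕ} (π : Equiv.Perm (Fin n)) : permWord π 0 = 0 := by
  simp only [permWord, Nat.zero_lt_succ, dite_true]
  exact Fin.cons_zero _ _

theorem permWord_succ {n : ℕ} (π : Equiv.Perm (Fin n)) (i : Fin n) :
    permWord π (i + 1) = π i + 1 := by
  simp only [permWord, Nat.add_lt_add_iff_right, i.isLt, dite_true]
  exact Fin.cons_succ (α := fun _ => ℕ) 0 _ i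

theorem permWord_injOn {n : ℕ} (π : Equiv.Perm (Fin n)) {i j : ℕ} (hi : i ≤ n) (hj : j ≤ n)
    (h : permWord π i = permWord π j) : i = j := by
  rcases i with _ | i <;> rcases j with _ | j
  · rfl
  · simp [permWord_succ π ⟨j, hj⟩] at h
  · simp [permWord_succ π ⟨i, hi⟩] at h
  · have h1 := permWord_succ π ⟨i, hi⟩
    have h2 := permWord_succ π ⟨j, hj⟩
    simp only at h1 h2
    rw [h1, h2, Nat.add_right_cancel_iff, ← Fin.ext_iff, π.injective.eq_iff, Fin.ext_iff] at h
    simpa using h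

theorem udrun_eq_turns_add_one {n : ℕ} (π : Equiv.Perm (Fin (n + 1))) :
    udrun π = turns (ascentPattern (permWord π)) n + 1 := by
  refine ncard_isMaximalRun _ _ (fun i => ?_) fun i hi h => ?_
  · rw [permWord, dif_pos i.isLt]
  · exact absurd (permWord_injOn π (by omega) (by omega) h) (by omega)

/-- Insertion of a new maximum at position `p` of a permutation. -/
def insertMax {n : ℕ} (p : Fin (n + 1)) (π : Equiv.Perm (Fin n)) : Equiv.Perm (Fin (n + 1)) :=
  (finSuccEquiv' p).trans ((Equiv.optionCongr π).trans (finSuccEquiv' (Fin.last n)).symm)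

theorem insertMax_self {n : ℕ} (p : Fin (n + 1)) (π : Equiv.Perm (Fin n)) :
    insertMax p π p = Fin.last n := by
  simp [insertMax]

theorem insertMax_succAbove {n : ℕ} (p : Fin (n + 1)) (π : Equiv.Perm (Fin n)) (i : Fin n) :
    insertMax p π (p.succAbove i) = (π i).castSucc := by
  simp [insertMax]

theorem insertMax_bijective (n : ℕ) :
    Function.Bijective fun x : Fin (n + 1) × Equiv.Perm (Fin n) => insertMax x.1 x.2 := by
  rw [Fintype.bijective_iff_injective_and_card]
  constructor
  · rintro ⟨p, π⟩ ⟨q, σ⟩ h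
    simp only at h
    obtain rfl : p = q := (insertMax p π).injective (by
      rw [insertMax_self, h, insertMax_self])
    congr 1
    ext i
    have := congrArg (fun e => ((e (p.succAbove i) : Fin (n + 1)) : ℕ)) h
    simpa [insertMax_succAbove] using this
  · simp [Fintype.card_perm, Nat.factorial_succ]

theorem permWord_insertMax {n : ℕ} (p : Fin (n + 1)) (π : Equiv.Perm (Fin n)) {j : ℕ}
    (hj : j ≤ n + 1) :
    permWord (insertMax p π) j =
      if j ≤ p then permWord π j else if j = p + 1 then n + 1 else permWord π (j - 1) := by
  rcases j with _ | j
  · simp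
  have h0 := permWord_succ (insertMax p π) ⟨j, by omega⟩
  simp only at h0
  rw [h0]
  rcases lt_trichotomy j (p : ℕ) with h | h | h
  · have hp := p.isLt
    have h1 := permWord_succ π ⟨j, by omega⟩
    have h2 := insertMax_succAbove p π ⟨j, by omega⟩
    rw [Fin.succAbove_of_castSucc_lt _ _ (by simpa [Fin.lt_def] using h)] at h2
    simp only [Fin.castSucc_mk] at h1 h2
    rw [if_pos (by omega), h1, h2]
    simp
  · rw [if_neg (by omega), if_pos (by omega), show (⟨j, by omega⟩ : Fin (n + 1)) = p from
      Fin.ext h, insertMax_self]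
    simp
  · obtain ⟨i, rfl⟩ : ∃ i, j = i + 1 := ⟨j - 1, by omega⟩
    have h1 := permWord_succ π ⟨i, by omega⟩
    have h2 := insertMax_succAbove p π ⟨i, by omega⟩
    rw [Fin.succAbove_of_le_castSucc _ _ (by simp [Fin.le_def]; omega)] at h2
    simp only [Fin.succ_mk] at h1 h2
    rw [if_neg (by omega), if_neg (by omega), Nat.add_sub_cancel, h1, h2]
    simp

theorem permWord_le {n : ℕ} (π : Equiv.Perm (Fin n)) (j : ℕ) : permWord π j ≤ n := by
  rcases j with _ | j
  · simp
  by_cases h : j < n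
  · have := permWord_succ π ⟨j, h⟩
    simp only at this
    rw [this]
    exact (π ⟨j, h⟩).isLt
  · simp [permWord, h]

/-- The new maximum exceeds both its neighbours. When it is appended at the end, the descent of the
peak falls outside the range `j ≤ n`. -/
theorem ascentPattern_insertMax {n : ℕ} (p : Fin (n + 1)) (π : Equiv.Perm (Fin n)) {j : ℕ}
    (hj : j ≤ n) :
    ascentPattern (permWord (insertMax p π)) j =
      insertPeak p (ascentPattern (permWord π)) j := by
  have hp := p.isLt
  have h1 := permWord_le π p
  have h2 := permWord_le π (p + 1)
  simp only [ascentPattern, insertPeak]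
  rw [permWord_insertMax p π (by omega), permWord_insertMax p π (by omega)]
  rcases lt_trichotomy j (p : ℕ) with h | h | h
  · simp [h, h.le, Nat.succ_le_of_lt h]
  · subst h
    simp
    omega
  · obtain ⟨i, rfl⟩ : ∃ i, j = i + 1 := ⟨j - 1, by omega⟩
    by_cases hi : i = p
    · subst hi
      simp
      omega
    · have a1 : ¬ i + 1 ≤ p := by omega
      have a2 : ¬ i + 1 < p := by omega
      have a3 : ¬ i + 1 + 1 ≤ p := by omega
      have a4 : ¬ i + 1 = p := by omega
      simp [a1, a2, a3, a4, hi]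

/-! ### The recurrence -/

/-- The generating polynomial of permutations by number of turns. -/
noncomputable def turnPoly (n : ℕ) : ℝ[X] :=
  ∑ π : Equiv.Perm (Fin (n + 1)), X ^ turns (ascentPattern (permWord π)) n

theorem turns_le (s : ℕ → Bool) (m : ℕ) : turns s m ≤ m := by
  calc turns s m ≤ ∑ i ∈ Finset.range m, 1 :=
        Finset.sum_le_sum fun i _ => by split_ifs <;> simp
    _ = m := by simp

theorem natCast_mul_X_pow_eq (k : ℕ) :
    (k : ℝ[X]) * X ^ k = X * derivative (X ^ k : ℝ[X]) := by
  rcases k with _ | k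
  · simp
  · rw [derivative_X_pow, Nat.add_sub_cancel, C_eq_natCast]
    ring

theorem turnPoly_succ (n : ℕ) :
    turnPoly (n + 1) = (1 + X + C (n : ℝ) * X ^ 2) * turnPoly n
      + X * (1 - X ^ 2) * derivative (turnPoly n) := by
  simp only [turnPoly]
  rw [← Fintype.sum_bijective _ (insertMax_bijective (n + 1)) (fun x =>
    (X : ℝ[X]) ^ turns (insertPeak x.1 (ascentPattern (permWord x.2))) (n + 1)) _
    (fun x => by rw [turns_congr fun i hi => (ascentPattern_insertMax x.1 x.2 hi)]),
    Fintype.sum_prod_type_right, derivative_sum, Finset.mul_sum, Finset.mul_sum,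
    ← Finset.sum_add_distrib]
  refine Finset.sum_congr rfl fun π _ => ?_
  -- The leading `0` forces an initial ascent, so only the first half of the insertion count is
  -- needed here.
  have h0 : ascentPattern (permWord π) 0 = true := by
    have := permWord_succ π 0
    simp only [Fin.val_zero] at this
    simp [ascentPattern, this]
  have := (sum_X_pow_turns_insertPeak n (ascentPattern (permWord π))).1 h0
  rw [← Fin.sum_univ_eq_sum_range (fun p =>
    (X : ℝ[X]) ^ turns (insertPeak p (ascentPattern (permWord π))) (n + 1))] at this
  rw [this]
  have hk := natCast_mul_X_pow_eq (turns (ascentPattern (permWord π)) n)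
  rw [C_eq_natCast]
  linear_combination (1 - X ^ 2) * hk

theorem sum_range_two_mul {M : Type*} [AddCommMonoid M] (g : ℕ → M) (m : ℕ) :
    ∑ j ∈ Finset.range (2 * m), g j = ∑ k ∈ Finset.range m, (g (2 * k) + g (2 * k + 1)) := by
  induction m with
  | zero => simp
  | succ m ih =>
    rw [show 2 * (m + 1) = 2 * m + 1 + 1 by ring, Finset.sum_range_succ, Finset.sum_range_succ,
      Finset.sum_range_succ, ih, add_assoc]

theorem turnPoly_eq_sum_range (n N : ℕ) (hN : n < N) :
    turnPoly n = ∑ j ∈ Finset.range N, C (udrunCount (n + 1) (j + 1) : ℝ) * X ^ j := by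
  rw [turnPoly, ← Finset.sum_fiberwise_of_maps_to (s := Finset.univ) (t := Finset.range N)
    (g := fun π : Equiv.Perm (Fin (n + 1)) => turns (ascentPattern (permWord π)) n)
    (fun π _ => Finset.mem_range.2 ((turns_le _ _).trans_lt hN))]
  refine Finset.sum_congr rfl fun j _ => ?_
  rw [Finset.sum_congr rfl (g := fun _ => X ^ j) fun π hπ => by rw [(Finset.mem_filter.1 hπ).2],
    Finset.sum_const, nsmul_eq_mul, C_eq_natCast]
  congr 2
  rw [udrunCount, ← Set.ncard_coe_finset]
  congr 1
  ext π
  simp [udrun_eq_turns_add_one]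

theorem fPoly_succ_eq_two_mul_turnPoly (n : ℕ) : fPoly (n + 1) = C 2 * turnPoly n := by
  -- The range is padded to twice that of `xiPoly` and `zetaPoly`, so that exponents `2k` and `2k +
  -- 1` pair up term by term.
  rw [turnPoly_eq_sum_range n (2 * (n + 1 + 1)) (by omega), sum_range_two_mul, fPoly, xiPoly,
    zetaPoly, Polynomial.sum_comp, Polynomial.sum_comp, Finset.mul_sum,
    Finset.mul_sum, Finset.mul_sum, ← Finset.sum_add_distrib]
  refine Finset.sum_congr rfl fun k _ => ?_
  simp only [mul_comp, C_comp, pow_comp, X_comp, xiCoeff, zetaCoeff, Nat.cast_mul, C_mul,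
    Nat.cast_ofNat]
  ring

theorem fPoly_one : fPoly 1 = C 2 := by
  rw [fPoly_succ_eq_two_mul_turnPoly, turnPoly]
  simp [turns]

theorem fPoly_recurrence (n : ℕ) (hn : 1 ≤ n) :
    fPoly (n + 1) = (1 + X + C ((n : ℝ) - 1) * X ^ 2) * fPoly n
      + X * (1 - X ^ 2) * derivative (fPoly n) := by
  obtain ⟨n, rfl⟩ : ∃ m, n = m + 1 := ⟨n - 1, by omega⟩
  rw [fPoly_succ_eq_two_mul_turnPoly, fPoly_succ_eq_two_mul_turnPoly, turnPoly_succ,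
    derivative_C_mul]
  push_cast
  rw [add_sub_cancel_right]
  ring

/-! ### Polynomials given by a list of real zeros -/

/-- The polynomial `c ∏_{i < r} (X - x i)`. -/
noncomputable def rootsProd (c : ℝ) (r : ℕ) (x : ℕ → ℝ) : ℝ[X] :=
  C c * ∏ i ∈ Finset.range r, (X - C (x i))

theorem rootsProd_eq_multiset_prod (c : ℝ) (r : ℕ) (x : ℕ → ℝ) :
    rootsProd c r x =
      C c * (((Multiset.range r).map x).map fun a => X - C a).prod := by
  rw [rootsProd, Multiset.map_map]
  rfl

theorem eval_rootsProd (c : ℝ) (r : ℕ) (x : ℕ → ℝ) (t : ℝ) :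
    (rootsProd c r x).eval t = c * ∏ i ∈ Finset.range r, (t - x i) := by
  simp [rootsProd, eval_prod]

theorem rootsProd_ne_zero {c : ℝ} (hc : c ≠ 0) (r : ℕ) (x : ℕ → ℝ) : rootsProd c r x ≠ 0 :=
  mul_ne_zero (C_ne_zero.2 hc) (Finset.prod_ne_zero_iff.2 fun _ _ => X_sub_C_ne_zero _)

theorem roots_rootsProd {c : ℝ} (hc : c ≠ 0) (r : ℕ) (x : ℕ → ℝ) :
    (rootsProd c r x).roots = (Multiset.range r).map x := by
  rw [rootsProd_eq_multiset_prod, roots_C_mul _ hc, roots_multiset_prod_X_sub_C]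

theorem natDegree_rootsProd {c : ℝ} (hc : c ≠ 0) (r : ℕ) (x : ℕ → ℝ) :
    (rootsProd c r x).natDegree = r := by
  rw [rootsProd_eq_multiset_prod, natDegree_C_mul hc, natDegree_multiset_prod_X_sub_C_eq_card]
  simp

theorem RZ_rootsProd {c : ℝ} (hc : c ≠ 0) {r : ℕ} {x : ℕ → ℝ} {I : Set ℝ}
    (h : ∀ i < r, x i ∈ I) : RZ I (rootsProd c r x) := by
  refine ⟨rootsProd_ne_zero hc r x, fun z hz => ?_⟩
  rw [rootsProd, map_mul, aeval_C, map_prod, mul_eq_zero, Finset.prod_eq_zero_iff] at hz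
  rcases hz with hz | ⟨i, hi, hz⟩
  · simp [hc] at hz
  · refine ⟨x i, h i (Finset.mem_range.1 hi), ?_⟩
    simpa [sub_eq_zero] using hz

theorem isRoot_rootsProd_iff {c : ℝ} (hc : c ≠ 0) (r : ℕ) (x : ℕ → ℝ) (t : ℝ) :
    (rootsProd c r x).IsRoot t ↔ ∃ i < r, x i = t := by
  rw [← mem_roots (rootsProd_ne_zero hc r x), roots_rootsProd hc]
  simp

/-- The `r` distinct roots already exhaust the root multiset, whose size is at most the degree. -/
theorem eq_rootsProd_of_isRoot {p : ℝ[X]} {r : ℕ} {x : ℕ → ℝ} (hp : p ≠ 0)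
    (hdeg : p.natDegree ≤ r) (hinj : Set.InjOn x (Set.Iio r)) (hroot : ∀ i < r, p.IsRoot (x i)) :
    p = rootsProd p.leadingCoeff r x := by
  have hle : (Multiset.range r).map x ≤ p.roots := by
    rw [Multiset.le_iff_subset]
    · intro a ha
      obtain ⟨i, hi, rfl⟩ := Multiset.mem_map.1 ha
      exact (mem_roots hp).2 (hroot i (Multiset.mem_range.1 hi))
    · exact Multiset.Nodup.map_on (fun i hi j hj h => hinj (Multiset.mem_range.1 hi)
        (Multiset.mem_range.1 hj) h) (Multiset.nodup_range r)
  have hcard : p.roots.card ≤ ((Multiset.range r).map x).card := by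
    simpa using (card_roots' p).trans hdeg
  have heq := Multiset.eq_of_le_of_card_le hle hcard
  have h1 := Multiset.card_le_card hle
  have h2 := card_roots' p
  simp only [Multiset.card_map, Multiset.card_range] at h1
  rw [rootsProd_eq_multiset_prod, heq, C_leadingCoeff_mul_prod_multiset_X_sub_C (by omega)]

theorem map_univ_fin_val (x : ℕ → ℝ) (d : ℕ) :
    (Finset.univ : Finset (Fin d)).val.map (fun i : Fin d => x i) = (Multiset.range d).map x := by
  have h := congrArg Finset.val (Fin.map_valEmbedding_univ (n := d))
  rw [Finset.map_val, Nat.Iio_eq_range] at h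
  exact (Multiset.map_map x (fun i : Fin d => (i : ℕ)) _).symm.trans (congrArg _ h)

theorem monotone_fin_of_le_succ {x : ℕ → ℝ} {d : ℕ} (h : ∀ i, i + 1 < d → x i ≤ x (i + 1)) :
    Monotone fun i : Fin d => x i := by
  intro i j hij
  rcases hij.eq_or_lt with rfl | hij
  · exact le_rfl
  · exact rel_of_forall_rel_succ_of_mem_Ico (· ≤ ·) x (a := i) (b := j)
      (fun k _ h2 => h k (by omega)) le_rfl hij le_rfl

theorem interlaces_rootsProd {c d : ℝ} (hc : c ≠ 0) (hd : d ≠ 0) {r : ℕ} {u v : ℕ → ℝ}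
    (h : ∀ i < r, v i ≤ u i ∧ u i ≤ v (i + 1)) :
    Interlaces (rootsProd c r u) (rootsProd d (r + 1) v) := by
  have h1 := natDegree_rootsProd hc r u
  refine ⟨RZ_rootsProd hc fun _ _ => trivial, RZ_rootsProd hd fun _ _ => trivial, ?_,
    fun i => u i, fun i => v i, ?_, ?_, ?_, ?_, ?_⟩
  · rw [h1, natDegree_rootsProd hd, add_comm]
  · exact monotone_fin_of_le_succ fun i hi =>
      (h i (by omega)).2.trans (h (i + 1) (by omega)).1
  · exact monotone_fin_of_le_succ fun i hi => (h i (by omega)).1.trans (h i (by omega)).2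
  · rw [map_univ_fin_val, roots_rootsProd hc, h1]
  · rw [map_univ_fin_val, roots_rootsProd hd, h1]
  · intro i
    exact h i (by have := i.isLt; omega)

theorem alternatesLeft_rootsProd {c d : ℝ} (hc : c ≠ 0) (hd : d ≠ 0) {r : ℕ} {u v : ℕ → ℝ}
    (h : ∀ i < r, u i ≤ v i) (h' : ∀ i, i + 1 < r → v i ≤ u (i + 1)) :
    AlternatesLeft (rootsProd c r u) (rootsProd d r v) := by
  have h1 := natDegree_rootsProd hc r u
  refine ⟨RZ_rootsProd hc fun _ _ => trivial, RZ_rootsProd hd fun _ _ => trivial, ?_,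
    fun i => u i, fun i => v i, ?_, ?_, ?_, ?_, ?_, ?_⟩
  · rw [h1, natDegree_rootsProd hd]
  · exact monotone_fin_of_le_succ fun i hi => (h i (by omega)).trans (h' i (by omega))
  · exact monotone_fin_of_le_succ fun i hi => (h' i (by omega)).trans (h (i + 1) (by omega))
  · rw [map_univ_fin_val, roots_rootsProd hc, h1]
  · rw [map_univ_fin_val, roots_rootsProd hd, h1]
  · exact fun i => h i (by have := i.isLt; omega)
  · intro i j hij
    have := h' i (by have := j.isLt; omega)
    rwa [hij] at this

theorem lt_of_lt_succ_of_lt {x : ℕ → ℝ} {r : ℕ} (h : ∀ i, i + 1 < r → x i < x (i + 1)) {i j : ℕ}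
    (hij : i < j) (hj : j < r) : x i < x j :=
  rel_of_forall_rel_succ_of_mem_Ico (· < ·) x (a := i) (b := j)
    (fun k _ h2 => h k (by omega)) le_rfl hij le_rfl

theorem injOn_of_lt_succ {x : ℕ → ℝ} {r : ℕ} (h : ∀ i, i + 1 < r → x i < x (i + 1)) :
    Set.InjOn x (Set.Iio r) := by
  intro i hi j hj hij
  rcases lt_trichotomy i j with h' | h' | h'
  · exact absurd hij (lt_of_lt_succ_of_lt h h' hj).ne
  · exact h'
  · exact absurd hij (lt_of_lt_succ_of_lt h h' hi).ne'

/-! ### Locating zeros by sign changes -/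

/-- A polynomial of degree at most `r` with alternating signs at `r + 1` points has exactly one
zero between any two neighbours among them. -/
theorem exists_eq_rootsProd_of_alternating {r : ℕ} {z : ℕ → ℝ} {h : ℝ[X]}
    (hz : ∀ i < r, z i < z (i + 1)) (hdeg : h.natDegree ≤ r)
    (hsign : ∀ i ≤ r, 0 < (-1) ^ (r + i) * h.eval (z i)) :
    ∃ c > 0, ∃ y : ℕ → ℝ, (∀ i < r, z i < y i ∧ y i < z (i + 1)) ∧ h = rootsProd c r y := by
  have hex : ∀ i, ∃ t, i < r → z i < t ∧ t < z (i + 1) ∧ h.IsRoot t := by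
    intro i
    by_cases hi : i < r
    · have h1 := hsign i hi.le
      have h2 := hsign (i + 1) hi
      rw [← add_assoc, pow_succ] at h2
      obtain ⟨t, ht, h0⟩ := intermediate_value_Ioo' (hz i hi).le
        (f := fun t => (-1) ^ (r + i) * h.eval t) (by fun_prop)
        (show (0 : ℝ) ∈ Set.Ioo _ _ from ⟨by linarith, h1⟩)
      refine ⟨t, fun _ => ⟨ht.1, ht.2, ?_⟩⟩
      simpa using h0
    · exact ⟨0, fun h => absurd h hi⟩
  choose y hy using hex
  have hne : h ≠ 0 := by
    rintro rfl
    simpa using hsign r le_rfl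
  have hlt : ∀ i, i + 1 < r → y i < y (i + 1) := fun i hi =>
    (hy i (by omega)).2.1.trans (hy (i + 1) hi).1
  have heq := eq_rootsProd_of_isRoot hne hdeg (injOn_of_lt_succ hlt) fun i hi => (hy i hi).2.2
  refine ⟨h.leadingCoeff, ?_, y, fun i hi => ⟨(hy i hi).1, (hy i hi).2.1⟩, heq⟩
  -- The last point lies to the right of every `y i`, so the sign there is that of the leading
  -- coefficient.
  have hr := hsign r le_rfl
  rw [← two_mul, pow_mul, neg_one_sq, one_pow, one_mul, heq, eval_rootsProd] at hr
  refine pos_of_mul_pos_left hr (Finset.prod_nonneg fun i hi => ?_)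
  have hi := Finset.mem_range.1 hi
  have := rel_of_forall_rel_succ_of_mem_Ico (· ≤ ·) z (a := i + 1) (b := r)
    (fun k _ h2 => (hz k h2).le) le_rfl (y := r)
  have h3 : z (i + 1) ≤ z r := by
    rcases Nat.lt_or_ge (i + 1) r with h | h
    · exact this h le_rfl
    · rw [show i + 1 = r by omega]
  linarith [(hy i hi).2.1]

theorem eval_rootsProd_pos {c : ℝ} (hc : 0 < c) {r : ℕ} {x : ℕ → ℝ} {t : ℝ}
    (h : ∀ i < r, x i < t) : 0 < (rootsProd c r x).eval t := by
  rw [eval_rootsProd]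
  exact mul_pos hc (Finset.prod_pos fun i hi => sub_pos.2 (h i (Finset.mem_range.1 hi)))

theorem neg_one_pow_mul_eval_rootsProd_pos {c : ℝ} (hc : 0 < c) {r : ℕ} {x : ℕ → ℝ} {t : ℝ}
    (h : ∀ i < r, t < x i) : 0 < (-1) ^ r * (rootsProd c r x).eval t := by
  have : (-1 : ℝ) ^ r = ∏ i ∈ Finset.range r, (-1) := by simp
  rw [eval_rootsProd, mul_left_comm, this, ← Finset.prod_mul_distrib]
  exact mul_pos hc (Finset.prod_pos fun i hi => by
    linarith [h i (Finset.mem_range.1 hi)])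

/-- At `x i` the derivative is the product of the other factors, of which the `r - i - 1` with
larger zeros are negative. -/
theorem neg_one_pow_mul_eval_derivative_rootsProd_pos {c : ℝ} (hc : 0 < c) {r : ℕ} {x : ℕ → ℝ}
    (h : ∀ i, i + 1 < r → x i < x (i + 1)) {i : ℕ} (hi : i < r) :
    0 < (-1) ^ (r + i + 1) * (derivative (rootsProd c r x)).eval (x i) := by
  obtain ⟨s, rfl⟩ : ∃ s, r = i + 1 + s := ⟨r - (i + 1), by omega⟩
  have hfac : rootsProd c (i + 1 + s) x =
      (X - C (x i)) * (rootsProd c i x * rootsProd 1 s fun j => x (i + 1 + j)) := by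
    simp only [rootsProd, Finset.prod_range_add, Finset.prod_range_succ, C_1]
    ring
  have h1 : 0 < (rootsProd c i x).eval (x i) :=
    eval_rootsProd_pos hc fun j hj => lt_of_lt_succ_of_lt h hj hi
  have h2 : 0 < (-1) ^ s * (rootsProd 1 s fun j => x (i + 1 + j)).eval (x i) :=
    neg_one_pow_mul_eval_rootsProd_pos one_pos fun j hj =>
      lt_of_lt_succ_of_lt h (by omega) (by omega)
  have hpow : (-1 : ℝ) ^ (i + 1 + s + i + 1) = (-1) ^ s := by
    rw [show i + 1 + s + i + 1 = 2 * (i + 1) + s by ring, pow_add, pow_mul]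
    simp
  rw [hfac, derivative_mul, hpow]
  simp only [derivative_sub, derivative_X, derivative_C, eval_add, eval_mul, eval_sub, eval_X,
    eval_C, sub_self, zero_mul, add_zero, sub_zero, one_mul]
  nlinarith [mul_pos h1 h2]

/-- Zeros move to the right, staying negative. -/
theorem exists_eq_rootsProd_right {c : ℝ} (hc : 0 < c) {r : ℕ} {x : ℕ → ℝ}
    (h : ∀ i, i + 1 < r → x i < x (i + 1)) (hx : ∀ i < r, x i < 0) {p : ℝ[X]}
    (hdeg : p.natDegree ≤ r) (h0 : 0 < p.eval 0)
    (hp : ∀ i < r, ∃ w < 0, p.eval (x i) = w * (derivative (rootsProd c r x)).eval (x i)) :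
    ∃ d > 0, ∃ y : ℕ → ℝ, (∀ i < r, x i < y i ∧ y i < 0) ∧
      (∀ i, i + 1 < r → y i < x (i + 1)) ∧ p = rootsProd d r y := by
  -- The test points are `x 0, …, x (r - 1), 0`.
  obtain ⟨d, hd, y, hy, heq⟩ := exists_eq_rootsProd_of_alternating
    (z := fun i => if i < r then x i else 0) (r := r) (h := p) (fun i hi => by
      by_cases hi' : i + 1 < r
      · simp [hi, hi', h i hi']
      · simp [hi, hi', hx i hi]) hdeg (fun i hi => by
      rcases hi.lt_or_eq with hi | rfl
      · obtain ⟨w, hw, hpw⟩ := hp i hi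
        have := neg_one_pow_mul_eval_derivative_rootsProd_pos hc h hi
        rw [pow_succ] at this
        simp only [hi, if_true]
        rw [hpw]
        nlinarith [mul_pos (neg_pos.2 hw) this]
      · simp only [lt_irrefl, if_false, ← two_mul, pow_mul, neg_one_sq, one_pow, one_mul]
        exact h0)
  refine ⟨d, hd, y, fun i hi => ⟨?_, ?_⟩, fun i hi => ?_, heq⟩
  · simpa [hi] using (hy i hi).1
  · by_cases hi' : i + 1 < r
    · exact (hy i hi).2.trans (by simp [hi', hx (i + 1) hi'])
    · simpa [hi'] using (hy i hi).2
  · simpa [hi] using (hy i (by omega)).2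

/-- One more zero appears, and the zeros interlace. -/
theorem exists_eq_rootsProd_interlacing {c a : ℝ} (hc : 0 < c) (ha : a < 0) {r : ℕ} {x : ℕ → ℝ}
    (h : ∀ i, i + 1 < r → x i < x (i + 1)) (hx : ∀ i < r, a < x i ∧ x i < 0) {p : ℝ[X]}
    (hdeg : p.natDegree ≤ r + 1) (h0 : 0 < p.eval 0)
    (hp : ∀ i < r, ∃ w < 0, p.eval (x i) = w * (derivative (rootsProd c r x)).eval (x i))
    (h1 : ∃ w < 0, p.eval a = w * (rootsProd c r x).eval a) :
    ∃ d > 0, ∃ y : ℕ → ℝ, (∀ i < r + 1, a < y i ∧ y i < 0) ∧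
      (∀ i < r, y i < x i ∧ x i < y (i + 1)) ∧ p = rootsProd d (r + 1) y := by
  -- The test points are `a, x 0, …, x (r - 1), 0`, whence the index shift and the extra zero.
  obtain ⟨d, hd, y, hy, heq⟩ := exists_eq_rootsProd_of_alternating
    (z := fun i => if i = 0 then a else if i < r + 1 then x (i - 1) else 0) (r := r + 1)
    (h := p) (fun i hi => by
      rcases i with _ | i
      · by_cases hr : 0 < r
        · simp [hr, (hx 0 hr).1]
        · simp [hr, ha]
      · have hi1 : i < r := by omega
        by_cases hi' : i + 1 < r
        · simp [hi1, hi', h i hi']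
        · simp [hi1, hi', (hx i hi1).2]) hdeg (fun i hi => by
      rcases i with _ | i
      · obtain ⟨w, hw, hpw⟩ := h1
        have := neg_one_pow_mul_eval_rootsProd_pos hc fun i hi => (hx i hi).1
        simp only [if_true, add_zero]
        rw [hpw, pow_succ]
        nlinarith [mul_pos (neg_pos.2 hw) this]
      · rcases hi.lt_or_eq with hi' | hi'
        · have hi1 : i < r := by omega
          obtain ⟨w, hw, hpw⟩ := hp i hi1
          have := neg_one_pow_mul_eval_derivative_rootsProd_pos hc h hi1
          simp only [hi', if_true, Nat.add_sub_cancel, Nat.succ_ne_zero, if_false]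
          rw [hpw, show r + 1 + (i + 1) = r + i + 1 + 1 by ring, pow_succ]
          nlinarith [mul_pos (neg_pos.2 hw) this]
        · obtain rfl : i = r := by omega
          simp only [lt_irrefl, if_false, ← two_mul, pow_mul, neg_one_sq, one_pow, one_mul,
            Nat.succ_ne_zero]
          exact h0)
  have key : ∀ i < r, y i < x i ∧ x i < y (i + 1) := fun i hi =>
    ⟨by simpa [hi] using (hy i (by omega)).2, by simpa [hi] using (hy (i + 1) (by omega)).1⟩
  refine ⟨d, hd, y, fun i hi => ⟨?_, ?_⟩, key, heq⟩
  · rcases i with _ | i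
    · simpa using (hy 0 hi).1
    · exact (hx i (by omega)).1.trans (key i (by omega)).2
  · by_cases hi' : i < r
    · exact (key i hi').1.trans (hx i hi').2
    · obtain rfl : i = r := by omega
      simpa using (hy i hi).2

/-! ### The zeros of `f_n` -/

theorem natDegree_fPoly_succ_le (n : ℕ) : (fPoly (n + 1)).natDegree ≤ n := by
  rw [fPoly_succ_eq_two_mul_turnPoly]
  refine (natDegree_C_mul_le _ _).trans ?_
  refine natDegree_sum_le_of_forall_le _ _ fun π _ => ?_
  rw [natDegree_X_pow]
  exact turns_le _ _

theorem X_add_one_mul_derivative_pow (m : ℕ) :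
    (X + 1) * derivative ((X + 1 : ℝ[X]) ^ m) = C (m : ℝ) * (X + 1) ^ m := by
  rcases m with _ | m
  · simp
  · rw [derivative_pow]
    simp only [derivative_add, derivative_X, derivative_one, Nat.add_sub_cancel, C_eq_natCast]
    ring

/-- The total coefficient of `g` is `1 + X + 2mX² + mX(1 - X) = (1 + X)(1 + mX)`, so a further
factor `X + 1` splits off. -/
theorem fPoly_even_step {m : ℕ} {g : ℝ[X]} (hg : fPoly (2 * m + 1) = (X + 1) ^ m * g) :
    fPoly (2 * m + 2) =
      (X + 1) ^ (m + 1) * ((1 + C (m : ℝ) * X) * g + X * (1 - X) * derivative g) := by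
  have h := X_add_one_mul_derivative_pow m
  rw [fPoly_recurrence _ (by omega), hg, derivative_mul]
  push_cast
  simp only [C_mul, C_ofNat, add_sub_cancel_right] at h ⊢
  linear_combination X * (1 - X) * g * h

theorem fPoly_odd_step {m : ℕ} {g : ℝ[X]} (hg : fPoly (2 * m + 2) = (X + 1) ^ (m + 1) * g) :
    fPoly (2 * m + 3) =
      (X + 1) ^ (m + 1) * ((1 + C ((m : ℝ) + 2) * X + C (m : ℝ) * X ^ 2) * g
        + X * (1 - X ^ 2) * derivative g) := by
  have h := X_add_one_mul_derivative_pow (m + 1)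
  rw [fPoly_recurrence _ (by omega), hg, derivative_mul]
  push_cast at h ⊢
  simp only [C_add, C_mul, C_sub, C_1, C_ofNat] at h ⊢
  linear_combination X * (1 - X) * g * h

/-- `f_n = (1 + x)^⌊n/2⌋ c ∏ (x - x_i)` with `⌊(n-1)/2⌋` increasing zeros `x_i ∈ (-1, 0)`. -/
structure FPolyFactorization (n : ℕ) (c : ℝ) (x : ℕ → ℝ) : Prop where
  pos : 0 < c
  mem : ∀ i < (n - 1) / 2, -1 < x i ∧ x i < 0
  lt_succ : ∀ i, i + 1 < (n - 1) / 2 → x i < x (i + 1)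
  eq : fPoly n = (X + 1) ^ (n / 2) * rootsProd c ((n - 1) / 2) x

/-- In the recurrences for the cofactor the top terms cancel. Bounding the degree of `f`
combinatorially and dividing out `(X + 1) ^ k` avoids computing this cancellation. -/
theorem natDegree_le_of_fPoly_eq {n k d : ℕ} {h : ℝ[X]} (hh : h ≠ 0)
    (heq : fPoly (n + 1) = (X + 1) ^ k * h) (hd : n ≤ k + d) : h.natDegree ≤ d := by
  have h1 := natDegree_fPoly_succ_le n
  have h2 : ((X + 1 : ℝ[X]) ^ k).natDegree = k := by
    rw [show (X + 1 : ℝ[X]) = X + C 1 by simp, natDegree_pow, natDegree_X_add_C, mul_one]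
  have h3 : (X + 1 : ℝ[X]) ^ k ≠ 0 := pow_ne_zero _ (by
    rw [show (X + 1 : ℝ[X]) = X + C 1 by simp]; exact X_add_C_ne_zero _)
  rw [heq, natDegree_mul h3 hh, h2] at h1
  omega

theorem FPolyFactorization.even_step {m : ℕ} {c : ℝ} {x : ℕ → ℝ}
    (h : FPolyFactorization (2 * m + 1) c x) :
    ∃ d y, FPolyFactorization (2 * m + 2) d y ∧ (∀ i < m, x i < y i) ∧
      ∀ i, i + 1 < m → y i < x (i + 1) := by
  obtain ⟨hc, hmem, hlt, heq⟩ := h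
  rw [show (2 * m + 1 - 1) / 2 = m by omega] at hmem hlt heq
  rw [show (2 * m + 1) / 2 = m by omega] at heq
  have hf := fPoly_even_step heq
  have h0 : 0 < (rootsProd c m x).eval 0 := eval_rootsProd_pos hc fun i hi => (hmem i hi).2
  set p := (1 + C (m : ℝ) * X) * rootsProd c m x + X * (1 - X) * derivative (rootsProd c m x)
    with hp
  have hp0 : 0 < p.eval 0 := by simpa [hp] using h0
  obtain ⟨d, hd, y, hy, hy', hpy⟩ := exists_eq_rootsProd_right hc hlt
    (fun i hi => (hmem i hi).2) (p := p)
    (natDegree_le_of_fPoly_eq (by rintro h; simp [h] at hp0) hf (by omega)) hp0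
    (fun i hi => ⟨x i * (1 - x i), by nlinarith [hmem i hi], by
      have : (rootsProd c m x).eval (x i) = 0 := (isRoot_rootsProd_iff hc.ne' m x _).2 ⟨i, hi, rfl⟩
      simp [hp, this]⟩)
  refine ⟨d, y, ⟨hd, ?_, ?_, ?_⟩, fun i hi => (hy i hi).1, hy'⟩
  · intro i hi
    have hi : i < m := by omega
    exact ⟨(hmem i hi).1.trans (hy i hi).1, (hy i hi).2⟩
  · intro i hi
    have hi : i + 1 < m := by omega
    exact (hy' i hi).trans (hy _ hi).1
  · rw [show (2 * m + 2 - 1) / 2 = m by omega, show (2 * m + 2) / 2 = m + 1 by omega, hf, hpy]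

theorem FPolyFactorization.odd_step {m : ℕ} {c : ℝ} {x : ℕ → ℝ}
    (h : FPolyFactorization (2 * m + 2) c x) :
    ∃ d y, FPolyFactorization (2 * m + 3) d y ∧ ∀ i < m, y i < x i ∧ x i < y (i + 1) := by
  obtain ⟨hc, hmem, hlt, heq⟩ := h
  rw [show (2 * m + 2 - 1) / 2 = m by omega] at hmem hlt heq
  rw [show (2 * m + 2) / 2 = m + 1 by omega] at heq
  have hf := fPoly_odd_step heq
  have h0 : 0 < (rootsProd c m x).eval 0 := eval_rootsProd_pos hc fun i hi => (hmem i hi).2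
  set p := (1 + C ((m : ℝ) + 2) * X + C (m : ℝ) * X ^ 2) * rootsProd c m x
    + X * (1 - X ^ 2) * derivative (rootsProd c m x) with hp
  have hp0 : 0 < p.eval 0 := by simpa [hp] using h0
  obtain ⟨d, hd, y, hy, hy', hpy⟩ := exists_eq_rootsProd_interlacing hc (a := -1) (by norm_num) hlt
    hmem (p := p)
    (natDegree_le_of_fPoly_eq (by rintro h; simp [h] at hp0) hf (by omega)) hp0
    (fun i hi => ⟨x i * (1 - x i ^ 2), by
      have h1 := hmem i hi
      exact mul_neg_of_neg_of_pos h1.2 (by nlinarith), by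
      have : (rootsProd c m x).eval (x i) = 0 := (isRoot_rootsProd_iff hc.ne' m x _).2 ⟨i, hi, rfl⟩
      simp [hp, this]⟩)
    -- At `-1` the derivative term vanishes and the coefficient of the old factor is `1 - (m + 2) +
    -- m = -1`.
    ⟨-1, by norm_num, by simp [hp]; ring⟩
  refine ⟨d, y, ⟨hd, ?_, ?_, ?_⟩, hy'⟩
  · intro i hi
    exact hy i (by omega)
  · intro i hi
    have hi : i < m := by omega
    exact (hy' i hi).1.trans (hy' i hi).2
  · rw [show (2 * m + 3 - 1) / 2 = m + 1 by omega, show (2 * m + 3) / 2 = m + 1 by omega, hf, hpy]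

theorem exists_fPolyFactorization (n : ℕ) : ∃ c x, FPolyFactorization (n + 1) c x := by
  induction n with
  | zero =>
    exact ⟨2, fun _ => 0, two_pos, by simp, by simp, by simp [fPoly_one, rootsProd]⟩
  | succ n ih =>
    obtain ⟨c, x, h⟩ := ih
    rcases Nat.even_or_odd' n with ⟨m, rfl | rfl⟩
    · obtain ⟨d, y, h, -⟩ := h.even_step
      exact ⟨d, y, h⟩
    · obtain ⟨d, y, h, -⟩ := h.odd_step
      exact ⟨d, y, h⟩

/-- The sequence `x`, with `k` terms `-1` put in front. -/
noncomputable def prependNegOnes (k : ℕ) (x : ℕ → ℝ) (i : ℕ) : ℝ := if i < k then -1 else x (i - k)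

theorem X_add_one_pow_mul_rootsProd (c : ℝ) (k r : ℕ) (x : ℕ → ℝ) :
    (X + 1) ^ k * rootsProd c r x = rootsProd c (k + r) (prependNegOnes k x) := by
  have h : ∏ i ∈ Finset.range k, (X - C (prependNegOnes k x i)) = (X + 1 : ℝ[X]) ^ k := by
    rw [Finset.prod_congr rfl (g := fun _ => (X + 1 : ℝ[X])) fun i hi => by
      simp [prependNegOnes, Finset.mem_range.1 hi], Finset.prod_const, Finset.card_range]
  rw [rootsProd, rootsProd, Finset.prod_range_add, h]
  simp only [prependNegOnes, Nat.add_sub_cancel_left, Nat.not_lt.2 (Nat.le_add_right k _),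
    if_false]
  ring

theorem FPolyFactorization.eq_rootsProd {n : ℕ} {c : ℝ} {x : ℕ → ℝ}
    (h : FPolyFactorization (n + 1) c x) :
    fPoly (n + 1) = rootsProd c n (prependNegOnes ((n + 1) / 2) x) := by
  rw [h.eq, X_add_one_pow_mul_rootsProd]
  congr 1
  omega

theorem FPolyFactorization.prependNegOnes_mem {n : ℕ} {c : ℝ} {x : ℕ → ℝ}
    (h : FPolyFactorization (n + 1) c x) {i : ℕ} (hi : i < n) :
    prependNegOnes ((n + 1) / 2) x i ∈ Set.Ico (-1 : ℝ) 0 := by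
  rw [prependNegOnes]
  split_ifs with hk
  · norm_num
  · have := h.mem (i - (n + 1) / 2) (by omega)
    exact ⟨this.1.le, this.2⟩

/-- When the zeros in `(-1, 0)` only move right, the additional `-1` shifts the indices by one and
restores interlacing. In the other step the number of `-1`s is unchanged and the inner zeros
interlace themselves. -/
theorem interlaces_fPoly (n : ℕ) : Interlaces (fPoly (n + 1)) (fPoly (n + 2)) := by
  obtain ⟨c, x, h⟩ := exists_fPolyFactorization n
  rcases Nat.even_or_odd' n with ⟨m, rfl | rfl⟩
  · obtain ⟨d, y, hy, h1, h2⟩ := h.even_step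
    rw [h.eq_rootsProd, hy.eq_rootsProd]
    refine interlaces_rootsProd h.pos.ne' hy.pos.ne' fun i hi => ?_
    have e1 : (2 * m + 1) / 2 = m := by omega
    have e2 : (2 * m + 1 + 1) / 2 = m + 1 := by omega
    have hxi := h.mem (i - m)
    rw [e1, e2]
    simp only [prependNegOnes]
    rcases lt_trichotomy i m with hlt | heq | hgt
    · simp [hlt, Nat.lt_succ_of_lt hlt]
    · subst heq
      have := h.mem 0 (by omega)
      have := h1 0 (by omega)
      simp
      constructor <;> linarith
    · rw [if_neg (by omega), if_neg (by omega), if_neg (by omega)]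
      have a1 := h2 (i - (m + 1)) (by omega)
      have a2 := h1 (i - m) (by omega)
      rw [show i - (m + 1) + 1 = i - m by omega] at a1
      rw [show i + 1 - (m + 1) = i - m by omega]
      exact ⟨a1.le, a2.le⟩
  · obtain ⟨d, y, hy, h1⟩ := h.odd_step
    rw [h.eq_rootsProd, hy.eq_rootsProd]
    refine interlaces_rootsProd h.pos.ne' hy.pos.ne' fun i hi => ?_
    have e1 : (2 * m + 1 + 1) / 2 = m + 1 := by omega
    have e2 : (2 * m + 1 + 1 + 1) / 2 = m + 1 := by omega
    rw [e1, e2]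
    simp only [prependNegOnes]
    rcases lt_trichotomy i m with hlt | heq | hgt
    · simp [hlt, Nat.lt_succ_of_lt hlt]
    · subst heq
      have := hy.mem 0 (by omega)
      simp
      linarith
    · rw [if_neg (by omega), if_neg (by omega), if_neg (by omega)]
      have a1 := h1 (i - (m + 1)) (by omega)
      rw [show i - (m + 1) + 1 = i + 1 - (m + 1) by omega] at a1
      exact ⟨a1.1.le, a1.2.le⟩

theorem RZ_fPoly (n : ℕ) : RZ (Set.Ico (-1) 0) (fPoly (n + 1)) := by
  obtain ⟨c, x, h⟩ := exists_fPolyFactorization n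
  rw [h.eq_rootsProd]
  exact RZ_rootsProd h.pos.ne' fun i hi => h.prependNegOnes_mem hi

theorem FPolyFactorization.roots_eq {n : ℕ} {c : ℝ} {x : ℕ → ℝ}
    (h : FPolyFactorization n c x) :
    (fPoly n).roots =
      Multiset.replicate (n / 2) (-1) + (Multiset.range ((n - 1) / 2)).map x := by
  have hX : (X + 1 : ℝ[X]) = X - C (-1) := by simp
  rw [h.eq, roots_mul, roots_rootsProd h.pos.ne', hX, roots_pow, roots_X_sub_C,
    Multiset.nsmul_singleton]
  rw [hX]
  exact mul_ne_zero (pow_ne_zero _ (X_sub_C_ne_zero _)) (rootsProd_ne_zero h.pos.ne' _ _)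

theorem count_map_range_eq_one {x : ℕ → ℝ} {r : ℕ} (h : ∀ i, i + 1 < r → x i < x (i + 1))
    {t : ℝ} (ht : ∃ i < r, x i = t) : ((Multiset.range r).map x).count t = 1 := by
  refine Multiset.count_eq_one_of_mem ?_ (by simpa using ht)
  exact Multiset.Nodup.map_on (fun i hi j hj h' => injOn_of_lt_succ h (Multiset.mem_range.1 hi)
        (Multiset.mem_range.1 hj) h') (Multiset.nodup_range r)

theorem FPolyFactorization.rootMultiplicity_neg_one {n : ℕ} {c : ℝ} {x : ℕ → ℝ}
    (h : FPolyFactorization n c x) : (fPoly n).rootMultiplicity (-1) = n / 2 := by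
  rw [← count_roots, h.roots_eq, Multiset.count_add, Multiset.count_replicate_self,
    Multiset.count_eq_zero_of_notMem, add_zero]
  intro hmem
  obtain ⟨i, hi, hxi⟩ := Multiset.mem_map.1 hmem
  exact (h.mem i (Multiset.mem_range.1 hi)).1.ne' hxi

theorem FPolyFactorization.isRoot_iff {n : ℕ} {c : ℝ} {x : ℕ → ℝ}
    (h : FPolyFactorization n c x) {t : ℝ} (ht : t ∈ Set.Ioo (-1 : ℝ) 0) :
    (fPoly n).IsRoot t ↔ ∃ i < (n - 1) / 2, x i = t := by
  have hne : t + 1 ≠ 0 := by linarith [ht.1]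
  rw [← isRoot_rootsProd_iff h.pos.ne', h.eq, IsRoot.def, IsRoot.def, eval_mul]
  simp [hne]

theorem FPolyFactorization.rootMultiplicity_eq_one {n : ℕ} {c : ℝ} {x : ℕ → ℝ}
    (h : FPolyFactorization n c x) {t : ℝ} (ht : t ∈ Set.Ioo (-1 : ℝ) 0)
    (hroot : (fPoly n).IsRoot t) : (fPoly n).rootMultiplicity t = 1 := by
  rw [← count_roots, h.roots_eq, Multiset.count_add,
    count_map_range_eq_one h.lt_succ ((h.isRoot_iff ht).1 hroot),
    Multiset.count_eq_zero_of_notMem]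
  intro hmem
  exact ht.1.ne' (Multiset.eq_of_mem_replicate hmem)

theorem FPolyFactorization.ncard_roots_Ioo {n : ℕ} {c : ℝ} {x : ℕ → ℝ}
    (h : FPolyFactorization n c x) :
    {t : ℝ | t ∈ Set.Ioo (-1) 0 ∧ (fPoly n).IsRoot t}.ncard = (n - 1) / 2 := by
  have : {t : ℝ | t ∈ Set.Ioo (-1) 0 ∧ (fPoly n).IsRoot t} = x '' (Set.Iio ((n - 1) / 2)) := by
    ext t
    constructor
    · rintro ⟨ht, hroot⟩
      exact (h.isRoot_iff ht).1 hroot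
    · rintro ⟨i, hi, rfl⟩
      exact ⟨h.mem i hi, (h.isRoot_iff (h.mem i hi)).2 ⟨i, hi, rfl⟩⟩
  rw [this, (injOn_of_lt_succ h.lt_succ).ncard_image, ← Finset.coe_Iio, Set.ncard_coe_finset,
    Nat.card_Iio]

/-! ### Degrees of `ξ_n` and `ζ_n` -/

theorem udrunCount_eq_zero {n k : ℕ} (hk : n + 1 < k) : udrunCount (n + 1) k = 0 := by
  rw [udrunCount, Set.ncard_eq_zero, Set.eq_empty_iff_forall_notMem]
  intro π hπ
  have h1 : udrun π = k := hπ
  have h2 := turns_le (ascentPattern (permWord π)) n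
  rw [udrun_eq_turns_add_one] at h1
  omega

theorem natDegree_xiPoly_le (n : ℕ) : (xiPoly (n + 1)).natDegree ≤ n / 2 := by
  refine natDegree_sum_le_of_forall_le _ _ fun k _ => ?_
  rcases Nat.lt_or_ge (n / 2) k with h | h
  · simp [xiCoeff, udrunCount_eq_zero (n := n) (k := 2 * k + 1) (by omega)]
  · exact (natDegree_C_mul_X_pow_le _ _).trans h

theorem natDegree_zetaPoly_le (n : ℕ) : (zetaPoly (n + 2)).natDegree ≤ n / 2 := by
  refine natDegree_sum_le_of_forall_le _ _ fun k _ => ?_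
  rcases Nat.lt_or_ge (n / 2) k with h | h
  · simp [zetaCoeff, udrunCount_eq_zero (n := n + 1) (k := 2 * k + 2) (by omega)]
  · exact (natDegree_C_mul_X_pow_le _ _).trans h

/-! ### Even and odd parts on the imaginary axis -/

/-- For `a < 0` the number `iy - a` lies in the right half-plane, so `arctan` gives a continuous
argument without branch cuts. -/
theorem exists_polar_of_neg {a : ℝ} (ha : a < 0) (y : ℝ) :
    ∃ ρ : ℝ, 0 < ρ ∧ (y : ℂ) * Complex.I - a =
      ρ * Complex.exp (Real.arctan (y / -a) * Complex.I) := by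
  have hne := ha.ne
  have hs : 0 < √(1 + (y / -a) ^ 2) := Real.sqrt_pos.2 (by positivity)
  refine ⟨-a * √(1 + (y / -a) ^ 2), mul_pos (by linarith) hs, ?_⟩
  apply Complex.ext
  · rw [Complex.re_ofReal_mul, Complex.exp_ofReal_mul_I_re, Real.cos_arctan]
    simp
    field_simp
  · rw [Complex.im_ofReal_mul, Complex.exp_ofReal_mul_I_im, Real.sin_arctan]
    simp
    field_simp

/-- The argument of `∏ (iy - u j)` for negative `u j`. -/
noncomputable def argSum (N : ℕ) (u : ℕ → ℝ) (y : ℝ) : ℝ :=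
  ∑ i ∈ Finset.range N, Real.arctan (y / -u i)

theorem argSum_zero (N : ℕ) (u : ℕ → ℝ) : argSum N u 0 = 0 := by simp [argSum]

theorem continuous_argSum (N : ℕ) (u : ℕ → ℝ) : Continuous (argSum N u) :=
  continuous_finsetSum _ fun _ _ => Real.continuous_arctan.comp (continuous_id.div_const _)

theorem monotone_argSum {N : ℕ} {u : ℕ → ℝ} (hu : ∀ i < N, u i < 0) : Monotone (argSum N u) := by
  intro y z hyz
  refine Finset.sum_le_sum fun i hi => Real.arctan_strictMono.monotone ?_
  have := hu i (Finset.mem_range.1 hi)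
  exact div_le_div_of_nonneg_right hyz (by linarith)

theorem tendsto_argSum {N : ℕ} {u : ℕ → ℝ} (hu : ∀ i < N, u i < 0) :
    Filter.Tendsto (argSum N u) Filter.atTop (nhds (N * (Real.pi / 2))) := by
  have h : Filter.Tendsto (argSum N u) Filter.atTop
      (nhds (∑ _i ∈ Finset.range N, Real.pi / 2)) := by
    refine tendsto_finsetSum _ fun i hi => ?_
    have := hu i (Finset.mem_range.1 hi)
    exact (Real.tendsto_arctan_atTop.mono_right nhdsWithin_le_nhds).comp
      (Filter.tendsto_id.atTop_div_const (by linarith))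
  simpa using h

theorem exists_argSum_eq {N : ℕ} {u : ℕ → ℝ} (hu : ∀ i < N, u i < 0) {s : ℝ} (hs : 0 < s)
    (hs' : s < N * (Real.pi / 2)) : ∃ y > 0, argSum N u y = s := by
  obtain ⟨b, hb, hb'⟩ := (((tendsto_argSum hu).eventually (lt_mem_nhds hs')).and
    (Filter.eventually_ge_atTop 0)).exists
  obtain ⟨y, hy, hys⟩ := intermediate_value_Ioo hb' (continuous_argSum N u).continuousOn
    (show s ∈ Set.Ioo _ _ from ⟨by rwa [argSum_zero], hb⟩)
  exact ⟨y, hy.1, hys⟩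

theorem exists_polar_rootsProd {c : ℝ} (hc : 0 < c) {N : ℕ} {u : ℕ → ℝ} (hu : ∀ i < N, u i < 0)
    (y : ℝ) : ∃ R : ℝ, 0 < R ∧ aeval ((y : ℂ) * Complex.I) (rootsProd c N u) =
      R * Complex.exp (argSum N u y * Complex.I) := by
  have h : ∀ i, ∃ ρ : ℝ, 0 < ρ ∧ (i < N → (y : ℂ) * Complex.I - u i =
      ρ * Complex.exp (Real.arctan (y / -u i) * Complex.I)) := fun i => by
    by_cases hi : i < N
    · obtain ⟨ρ, h1, h2⟩ := exists_polar_of_neg (hu i hi) y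
      exact ⟨ρ, h1, fun _ => h2⟩
    · exact ⟨1, one_pos, fun h => absurd h hi⟩
  choose ρ hρ h using h
  refine ⟨c * ∏ i ∈ Finset.range N, ρ i, mul_pos hc (Finset.prod_pos fun i _ => hρ i), ?_⟩
  rw [rootsProd, map_mul, aeval_C, map_prod, argSum, Complex.ofReal_mul, Complex.ofReal_prod,
    Complex.ofReal_sum, Finset.sum_mul, Complex.exp_sum, mul_assoc, ← Finset.prod_mul_distrib]
  congr 1
  refine Finset.prod_congr rfl fun i hi => ?_
  rw [← h i (Finset.mem_range.1 hi)]
  simp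

theorem aeval_mul_I_comp_X_sq (p : ℝ[X]) (y : ℝ) :
    aeval ((y : ℂ) * Complex.I) (p.comp (X ^ 2)) = ((p.eval (-y ^ 2) : ℝ) : ℂ) := by
  rw [aeval_comp, map_pow, aeval_X, mul_pow, Complex.I_sq,
    show (y : ℂ) ^ 2 * -1 = algebraMap ℝ ℂ (-y ^ 2) by simp,
    aeval_algebraMap_apply_eq_algebraMap_eval]
  rfl

/-- Substituting `iy` turns `X²` into `-y²`, which separates the two summands into real and
imaginary part. -/
theorem exists_eval_even_odd {c : ℝ} (hc : 0 < c) {N : ℕ} {u : ℕ → ℝ} (hu : ∀ i < N, u i < 0)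
    {p q : ℝ[X]} (h : rootsProd c N u = C 2 * p.comp (X ^ 2) + X * q.comp (X ^ 2)) (y : ℝ) :
    ∃ R : ℝ, 0 < R ∧ 2 * p.eval (-y ^ 2) = R * Real.cos (argSum N u y) ∧
      y * q.eval (-y ^ 2) = R * Real.sin (argSum N u y) := by
  obtain ⟨R, hR, hy⟩ := exists_polar_rootsProd hc hu y
  refine ⟨R, hR, ?_⟩
  rw [h, map_add, map_mul, map_mul, aeval_mul_I_comp_X_sq, aeval_mul_I_comp_X_sq, aeval_C,
    aeval_X] at hy
  have hre := congrArg Complex.re hy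
  have him := congrArg Complex.im hy
  rw [Complex.re_ofReal_mul, Complex.exp_ofReal_mul_I_re] at hre
  rw [Complex.im_ofReal_mul, Complex.exp_ofReal_mul_I_im] at him
  constructor
  · simpa using hre
  · simpa using him

/-- The even and odd parts of a polynomial with only negative zeros have negative, simple and
interlacing zeros. -/
theorem exists_even_odd_eq_rootsProd {c : ℝ} (hc : 0 < c) {N : ℕ} {u : ℕ → ℝ}
    (hu : ∀ i < N, u i < 0) (hN : 1 ≤ N) {p q : ℝ[X]}
    (h : rootsProd c N u = C 2 * p.comp (X ^ 2) + X * q.comp (X ^ 2))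
    (hp : p.natDegree ≤ N / 2) (hq : q.natDegree ≤ (N - 1) / 2) :
    ∃ a b : ℝ, ∃ t : ℕ → ℝ, a ≠ 0 ∧ b ≠ 0 ∧ (∀ j, t j < 0) ∧
      (∀ i j, 1 ≤ i → i < j → j < N → t j < t i) ∧
      p = rootsProd a (N / 2) (fun i => t (2 * (N / 2 - 1 - i) + 1)) ∧
      q = rootsProd b ((N - 1) / 2) (fun i => t (2 * ((N - 1) / 2 - 1 - i) + 2)) := by
  have hpi := Real.pi_pos
  have hN' : (1 : ℝ) ≤ N := by exact_mod_cast hN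
  have hev := exists_eval_even_odd hc hu h
  -- Where the argument equals `π/4`, sine and cosine are both positive, so neither part vanishes.
  obtain ⟨hp0, hq0⟩ : p ≠ 0 ∧ q ≠ 0 := by
    obtain ⟨y, hy, hys⟩ := exists_argSum_eq hu (s := Real.pi / 4) (by positivity) (by nlinarith)
    obtain ⟨R, hR, h1, h2⟩ := hev y
    rw [hys, Real.cos_pi_div_four] at h1
    rw [hys, Real.sin_pi_div_four] at h2
    have : 0 < R * (√2 / 2) := by positivity
    refine ⟨?_, ?_⟩ <;> rintro rfl
    · rw [eval_zero] at h1; linarith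
    · rw [eval_zero] at h2; linarith
  -- The default value `1` outside the range keeps every `y j` positive, hence every `-y j ^ 2`
  -- negative.
  have hex : ∀ j : ℕ, ∃ y > 0, 1 ≤ j → j < N → argSum N u y = j * (Real.pi / 2) := fun j => by
    by_cases hj : 1 ≤ j ∧ j < N
    · have h1 : (1 : ℝ) ≤ j := by exact_mod_cast hj.1
      have h2 : (j : ℝ) < N := by exact_mod_cast hj.2
      obtain ⟨y, hy, hys⟩ := exists_argSum_eq hu (s := j * (Real.pi / 2)) (by positivity)
        (by nlinarith)
      exact ⟨y, hy, fun _ _ => hys⟩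
    · exact ⟨1, one_pos, fun h1 h2 => absurd ⟨h1, h2⟩ hj⟩
  choose y hy hys using hex
  have hlt : ∀ i j, 1 ≤ i → i < j → j < N → -y j ^ 2 < -y i ^ 2 := fun i j hi hij hj => by
    have h1 : y i < y j := by
      refine (monotone_argSum hu).reflect_lt ?_
      rw [hys i hi (hij.trans hj), hys j (hi.trans hij.le) hj]
      have : (i : ℝ) < j := by exact_mod_cast hij
      nlinarith
    have := hy i
    nlinarith
  have hproot : ∀ k, 2 * k + 1 < N → p.IsRoot (-y (2 * k + 1) ^ 2) := fun k hk => by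
    obtain ⟨R, hR, h1, -⟩ := hev (y (2 * k + 1))
    have : Real.cos (((2 * k + 1 : ℕ) : ℝ) * (Real.pi / 2)) = 0 :=
      Real.cos_eq_zero_iff.2 ⟨k, by push_cast; ring⟩
    rw [hys _ (by omega) hk, this, mul_zero] at h1
    exact (mul_eq_zero.1 h1).resolve_left two_ne_zero
  have hqroot : ∀ k, 2 * k + 2 < N → q.IsRoot (-y (2 * k + 2) ^ 2) := fun k hk => by
    obtain ⟨R, hR, -, h1⟩ := hev (y (2 * k + 2))
    have : Real.sin (((2 * k + 2 : ℕ) : ℝ) * (Real.pi / 2)) = 0 :=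
      Real.sin_eq_zero_iff.2 ⟨k + 1, by push_cast; ring⟩
    rw [hys _ (by omega) hk, this, mul_zero] at h1
    exact (mul_eq_zero.1 h1).resolve_left (hy _).ne'
  -- The zeros `-y j ^ 2` decrease in `j`; the reversed indices in the statement list them
  -- increasingly.
  refine ⟨p.leadingCoeff, q.leadingCoeff, fun j => -y j ^ 2, leadingCoeff_ne_zero.2 hp0,
    leadingCoeff_ne_zero.2 hq0, fun j => neg_neg_of_pos (pow_pos (hy j) 2), hlt, ?_, ?_⟩
  · exact eq_rootsProd_of_isRoot hp0 hp
      (injOn_of_lt_succ fun i hi => hlt _ _ (by omega) (by omega) (by omega))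
      fun i hi => hproot _ (by omega)
  · exact eq_rootsProd_of_isRoot hq0 hq
      (injOn_of_lt_succ fun i hi => hlt _ _ (by omega) (by omega) (by omega))
      fun i hi => hqroot _ (by omega)

/-! ### Zeros of `ξ_n` and `ζ_n`, and conclusion -/

theorem onlyNegativeSimpleZeros_rootsProd {c : ℝ} (hc : c ≠ 0) {r : ℕ} {x : ℕ → ℝ}
    (hx : ∀ i < r, x i < 0) (hlt : ∀ i, i + 1 < r → x i < x (i + 1)) :
    OnlyNegativeSimpleZeros (rootsProd c r x) := by
  refine ⟨RZ_rootsProd hc hx, fun t ht => ?_⟩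
  rw [← count_roots, roots_rootsProd hc]
  exact count_map_range_eq_one hlt ((isRoot_rootsProd_iff hc r x t).1 ht)

theorem exists_xiPoly_zetaPoly_eq_rootsProd (n : ℕ) :
    ∃ a b : ℝ, ∃ t : ℕ → ℝ, a ≠ 0 ∧ b ≠ 0 ∧ (∀ j, t j < 0) ∧
      (∀ i j, 1 ≤ i → i < j → j < n + 1 → t j < t i) ∧
      xiPoly (n + 2) = rootsProd a ((n + 1) / 2) (fun i => t (2 * ((n + 1) / 2 - 1 - i) + 1)) ∧
      zetaPoly (n + 2) = rootsProd b (n / 2) (fun i => t (2 * (n / 2 - 1 - i) + 2)) := by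
  obtain ⟨c, x, h⟩ := exists_fPolyFactorization (n + 1)
  exact exists_even_odd_eq_rootsProd h.pos (fun i hi => (h.prependNegOnes_mem hi).2) (by omega)
    h.eq_rootsProd.symm (natDegree_xiPoly_le (n + 1)) (natDegree_zetaPoly_le n)

/-- This case is separate because `f_1` is constant: its argument on the imaginary axis never moves.
-/
theorem onlyNegativeSimpleZeros_xiPoly_one : OnlyNegativeSimpleZeros (xiPoly 1) := by
  have h1 := eq_C_of_natDegree_le_zero (natDegree_xiPoly_le 0)
  have h2 := congrArg (eval 0) fPoly_one
  rw [zero_add] at h1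
  rw [fPoly, h1] at h2
  simp only [eval_add, eval_mul, eval_C, C_comp, eval_X, zero_mul, add_zero] at h2
  have h3 : xiPoly 1 = rootsProd ((xiPoly 1).coeff 0) 0 fun _ => 0 := by
    rw [rootsProd, Finset.prod_range_zero, mul_one]
    exact h1
  rw [h3]
  refine onlyNegativeSimpleZeros_rootsProd ?_ (by simp) (by simp)
  intro h0
  rw [h0] at h2
  norm_num at h2

theorem mainTheorem2 :
    (fPoly 1 = C 2 ∧
      ∀ n : ℕ, 1 ≤ n →
        fPoly (n + 1) =
          (1 + X + C ((n : ℝ) - 1) * X ^ 2) * fPoly n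
            + X * (1 - X ^ 2) * derivative (fPoly n)) ∧
    (∀ n : ℕ, 1 ≤ n →
      RZ (Set.Ico (-1) 0) (fPoly n) ∧
      Interlaces (fPoly n) (fPoly (n + 1)) ∧
      {x : ℝ | x ∈ Set.Ioo (-1) 0 ∧ (fPoly n).IsRoot x}.ncard = (n - 1) / 2 ∧
      (∀ x ∈ Set.Ioo (-1 : ℝ) 0, (fPoly n).IsRoot x → (fPoly n).rootMultiplicity x = 1) ∧
      (fPoly n).rootMultiplicity (-1) = n / 2) ∧
    (∀ n : ℕ, 1 ≤ n → OnlyNegativeSimpleZeros (xiPoly n)) ∧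
    (∀ n : ℕ, 2 ≤ n → OnlyNegativeSimpleZeros (zetaPoly n)) ∧
    (∀ n : ℕ, 1 ≤ n → AlternatesLeft (zetaPoly (2 * n)) (xiPoly (2 * n))) ∧
    (∀ n : ℕ, 1 ≤ n → Interlaces (zetaPoly (2 * n + 1)) (xiPoly (2 * n + 1))) := by
  refine ⟨⟨fPoly_one, fPoly_recurrence⟩, fun n hn => ?_, fun n hn => ?_, fun n hn => ?_,
    fun n hn => ?_, fun n hn => ?_⟩
  · obtain ⟨n, rfl⟩ : ∃ m, n = m + 1 := ⟨n - 1, by omega⟩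
    obtain ⟨c, x, h⟩ := exists_fPolyFactorization n
    exact ⟨RZ_fPoly n, interlaces_fPoly n, h.ncard_roots_Ioo,
      fun t ht hroot => h.rootMultiplicity_eq_one ht hroot, h.rootMultiplicity_neg_one⟩
  · rcases hn.eq_or_lt with rfl | hn
    · exact onlyNegativeSimpleZeros_xiPoly_one
    obtain ⟨n, rfl⟩ : ∃ m, n = m + 2 := ⟨n - 2, by omega⟩
    obtain ⟨a, b, t, ha, hb, ht, hlt, hxi, hzeta⟩ := exists_xiPoly_zetaPoly_eq_rootsProd n
    rw [hxi]
    exact onlyNegativeSimpleZeros_rootsProd ha (fun i _ => ht _) fun i hi =>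
      hlt _ _ (by omega) (by omega) (by omega)
  · obtain ⟨n, rfl⟩ : ∃ m, n = m + 2 := ⟨n - 2, by omega⟩
    obtain ⟨a, b, t, ha, hb, ht, hlt, hxi, hzeta⟩ := exists_xiPoly_zetaPoly_eq_rootsProd n
    rw [hzeta]
    exact onlyNegativeSimpleZeros_rootsProd hb (fun i _ => ht _) fun i hi =>
      hlt _ _ (by omega) (by omega) (by omega)
  · obtain ⟨m, rfl⟩ : ∃ m, n = m + 1 := ⟨n - 1, by omega⟩
    obtain ⟨a, b, t, ha, hb, ht, hlt, hxi, hzeta⟩ := exists_xiPoly_zetaPoly_eq_rootsProd (2 * m)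
    rw [show (2 * m + 1) / 2 = m by omega] at hxi
    rw [show 2 * m / 2 = m by omega] at hzeta
    rw [mul_add_one, hxi, hzeta]
    -- Zeros of `ζ` carry the even indices of the decreasing sequence `t`, zeros of `ξ` the odd
    -- ones, so both comparisons are between neighbouring indices.
    exact alternatesLeft_rootsProd hb ha
      (fun i hi => (hlt _ _ (by omega) (by omega) (by omega)).le)
      fun i hi => (hlt _ _ (by omega) (by omega) (by omega)).le
  · obtain ⟨m, rfl⟩ : ∃ m, n = m + 1 := ⟨n - 1, by omega⟩
    obtain ⟨a, b, t, ha, hb, ht, hlt, hxi, hzeta⟩ :=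
      exists_xiPoly_zetaPoly_eq_rootsProd (2 * m + 1)
    rw [show (2 * m + 1 + 1) / 2 = m + 1 by omega] at hxi
    rw [show (2 * m + 1) / 2 = m by omega] at hzeta
    rw [show 2 * (m + 1) + 1 = 2 * m + 1 + 2 by ring, hxi, hzeta]
    exact interlaces_rootsProd hb ha fun i hi =>
      ⟨(hlt _ _ (by omega) (by omega) (by omega)).le,
        (hlt _ _ (by omega) (by omega) (by omega)).le⟩
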